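/- Let $\mathcal H$ be an infinite-dimensional separable complex Hilbert space and let $S$ be a bounded selfadjoint operator on $\mathcal H$. For $k\in\mathbb N$ put $$U_k(S)=\sup_P \operatorname{tr}(SP),\qquad L_k(S)=\inf_P \operatorname{tr}(SP),$$ where $P$ runs over the orthogonal projections of $\mathcal H$ onto $k$-dimensional subspaces. Let $\sigma_e(S)$ be the essential spectrum of $S$, i.e. the spectrum of the class of $S$ in the quotient of the algebra of bounded operators by the ideal of compact operators, and let $\|S\|_e=\inf\{\|S+K\| : K \text{ compact}\}$. Then $\alpha^+(S)=\max\sigma_e(S)$ and $\alpha_-(S)=\min\sigma_e(S)$ exist. With $E$ the spectral measure of $S$, let $$S^+=\int_{[\alpha^+(S),\|S\|]}(t-\alpha^+(S))\,dE(t),\qquad S_-=\int_{[-\|S\|,\alpha_-(S)]}(t-\alpha_-(S))\,dE(t).$$ Then $S^+$ and $S_-$ are compact, and for every $k\in\mathbb N$: 1. $U_k(S)=U_k(S^+)+k\,\alpha^+(S)$; 2. $L_k(S)=L_k(S_-)+k\,\alpha_-(S)$. In particular, $$\lim_{k\to\infty}\frac{U_k(S)}{k}=\alpha^+(S)=\max\sigma_e(S)\qquad\text{and}\qquad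 \lim_{k\to\infty}\frac{L_k(S)}{k}=\alpha_-(S)=\min\sigma_e(S).$$ Moreover $\|S\|_e=\max\{\alpha^+(S),-\alpha_-(S)\}$, so that $\lim_{k\to\infty} U_k(S)/k=\|S\|_e$ whenever $-\alpha_-(S)\le\alpha^+(S)$, in particular whenever $S\ge 0$. -/

import Mathlib

open Filter Topology

namespace SelfAdjointSchurHorn

variable {H : Type*} [NormedAddCommGroup H] [InnerProductSpace ℂ H]

/-- The two-sided ideal of compact operators in the algebra of bounded operators. -/
def compactIdeal (H : Type*) [NormedAddCommGroup H] [InnerProductSpace ℂ H] :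
    Ideal (H →L[ℂ] H) where
  carrier := {K | IsCompactOperator K}
  add_mem' hf hg := hf.add hg
  zero_mem' := isCompactOperator_zero
  smul_mem' A _ hK := IsCompactOperator.clm_comp hK A

instance compactIdeal_isTwoSided : (compactIdeal H).IsTwoSided where
  mul_mem_of_left {_} B hK := IsCompactOperator.comp_clm hK B

/-- The essential spectrum: the spectrum of the class of `T` in the Calkin algebra, the quotient
of the algebra of bounded operators by the ideal of compact operators. -/
noncomputable def essSpectrum (T : H →L[ℂ] H) : Set ℂ :=
  spectrum ℂ (Ideal.Quotient.mk (compactIdeal H) T)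

/-- The essential norm `inf {‖T + K‖ : K compact}`. -/
noncomputable def essNorm (T : H →L[ℂ] H) : ℝ :=
  sInf {r : ℝ | ∃ K : H →L[ℂ] H, IsCompactOperator K ∧ r = ‖T + K‖}

/-- `α⁺(S)`, the largest (real) point of the essential spectrum of a selfadjoint `S`. -/
noncomputable def alphaPlus (S : H →L[ℂ] H) : ℝ :=
  sSup {t : ℝ | (t : ℂ) ∈ essSpectrum S}

/-- `α₋(S)`, the smallest (real) point of the essential spectrum of a selfadjoint `S`. -/
noncomputable def alphaMinus (S : H →L[ℂ] H) : ℝ :=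
  sInf {t : ℝ | (t : ℂ) ∈ essSpectrum S}

variable [CompleteSpace H]

/-- `S⁺ = ∫ (t - α⁺(S)) dE(t)` over `[α⁺(S), ‖S‖]`, where `E` is the spectral measure of the
selfadjoint operator `S`. The integral `∫ f dE = f(S)` is the functional calculus of `S` applied to
`f`; here `f` is the integrand times the indicator function of the interval, which is continuous on
the spectrum of `S` because the spectrum lies in `[-‖S‖, ‖S‖]`. -/
noncomputable def plusPart (S : H →L[ℂ] H) : H →L[ℂ] H :=
  cfc (R := ℝ) ((Set.Icc (alphaPlus S) ‖S‖).indicator fun t => t - alphaPlus S) S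

/-- `S₋ = ∫ (t - α₋(S)) dE(t)` over `[-‖S‖, α₋(S)]`, where `E` is the spectral measure of the
selfadjoint operator `S`. -/
noncomputable def minusPart (S : H →L[ℂ] H) : H →L[ℂ] H :=
  cfc (R := ℝ) ((Set.Icc (-‖S‖) (alphaMinus S)).indicator fun t => t - alphaMinus S) S

/-- The trace `∑ ⟨b i, T (b i)⟩` over a Hilbert basis `b` (used for finite rank operators, for which
the sum converges absolutely and does not depend on the basis). -/
noncomputable def opTrace (T : H →L[ℂ] H) : ℂ :=
  ∑' i, inner ℂ ((exists_hilbertBasis ℂ H).choose_spec.choose i)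
    (T ((exists_hilbertBasis ℂ H).choose_spec.choose i))

/-- The orthogonal projections onto `k`-dimensional subspaces. The rank is a cardinal, so that
`k = 0` leaves only the zero projection. -/
def projections (H : Type*) [NormedAddCommGroup H] [InnerProductSpace ℂ H] [CompleteSpace H]
    (k : ℕ) : Set (H →L[ℂ] H) :=
  {P | IsStarProjection P ∧ Module.rank ℂ (LinearMap.range P.toLinearMap) = k}

/-- `U_k(S) = sup tr(SP)` over the orthogonal projections `P` of rank `k`
(for selfadjoint `S` the trace is real). -/
noncomputable def upperSum (k : ℕ) (S : H →L[ℂ] H) : ℝ :=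
  sSup {r : ℝ | ∃ P ∈ projections H k, r = (opTrace (S * P)).re}

/-- `L_k(S) = inf tr(SP)` over the orthogonal projections `P` of rank `k`. -/
noncomputable def lowerSum (k : ℕ) (S : H →L[ℂ] H) : ℝ :=
  sInf {r : ℝ | ∃ P ∈ projections H k, r = (opTrace (S * P)).re}

end SelfAdjointSchurHorn

open SelfAdjointSchurHorn

/-! The number α⁺ is the least `b` for which `(S - b)⁺` is compact
(`exists_isGreatest_essSpectrum`). Traces `tr(SP)` are sums `∑ ⟨e i, S e i⟩` over orthonormal
families, and `U_k(S) ≤ U_k(S⁺) + k α⁺` because `s ≤ (s - α⁺)⁺ + α⁺` pointwise.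

The reverse inequality rests on `exists_orthonormal_posPart_le`. For `ε > 0` the operator `(S - α⁺ +
ε)⁺` is not compact, so `S ≥ α⁺ - ε` on an infinite-dimensional subspace. There is room there to
move isometrically the component of each `e i` lying below α⁺, orthogonally to everything else; the
moved family loses at most `2ε` per vector.

Compactness of S⁺ makes `U_k(S⁺)` of order `o(k)`, which gives the limit. The statements on `L_k`,
α₋ and S₋ follow by passing to `-S`. Subtracting S⁺ and S₋ truncates `S` to `[α₋, α⁺]`, whence the
essential norm. -/

namespace SelfAdjointSchurHorn

/-! ### Essential spectrum and the Calkin algebra. -/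

section EssentialSpectrum

variable {H : Type*} [NormedAddCommGroup H] [InnerProductSpace ℂ H]

lemma essSpectrum_subset_spectrum (S : H →L[ℂ] H) : essSpectrum S ⊆ spectrum ℂ S := by
  intro z hz hu
  refine hz ?_
  have := hu.map (Ideal.Quotient.mk (compactIdeal H))
  rwa [map_sub] at this

lemma essSpectrum_congr {S T : H →L[ℂ] H} (h : IsCompactOperator (S - T)) :
    essSpectrum S = essSpectrum T := by
  unfold essSpectrum
  rw [Ideal.Quotient.eq.mpr (show S - T ∈ compactIdeal H from h)]

lemma essSpectrum_neg (S : H →L[ℂ] H) : essSpectrum (-S) = -essSpectrum S := by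
  unfold essSpectrum
  rw [map_neg, spectrum.neg_eq]

lemma exists_compact_parametrix {S : H →L[ℂ] H} {z : ℂ} (hz : z ∉ essSpectrum S) :
    ∃ B : H →L[ℂ] H, IsCompactOperator (B * (algebraMap ℂ (H →L[ℂ] H) z - S) - 1 : H →L[ℂ] H) := by
  have hu : IsUnit (Ideal.Quotient.mk (compactIdeal H) (algebraMap ℂ (H →L[ℂ] H) z - S)) := by
    by_contra h
    exact hz (by unfold essSpectrum; rw [spectrum.mem_iff]; rwa [map_sub] at h)
  obtain ⟨b, hb⟩ := hu.exists_left_inv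
  obtain ⟨B, rfl⟩ := Ideal.Quotient.mk_surjective b
  rw [← map_mul, ← map_one (Ideal.Quotient.mk (compactIdeal H)), Ideal.Quotient.eq] at hb
  exact ⟨B, hb⟩

end EssentialSpectrum

/-! ### Compactness of functions of `S` and the top of the essential spectrum. -/

section FunctionalCalculus

variable {H : Type*} [NormedAddCommGroup H] [InnerProductSpace ℂ H] [CompleteSpace H]

lemma abs_le_norm_of_mem_spectrum {S : H →L[ℂ] H} (hS : IsSelfAdjoint S) {t : ℝ}
    (ht : t ∈ spectrum ℝ S) : |t| ≤ ‖S‖ :=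
  IsometricContinuousFunctionalCalculus.norm_spectrum_le (𝕜 := ℝ) S ht hS

lemma cfc_const_sub_id {S : H →L[ℂ] H} (hS : IsSelfAdjoint S) (t : ℝ) :
    cfc (fun s : ℝ => t - s) S = algebraMap ℂ (H →L[ℂ] H) t - S := by
  rw [cfc_sub (fun _ : ℝ => t) (fun s : ℝ => s) S, cfc_const t S, cfc_id' ℝ S]
  rfl

lemma isCompactOperator_cfc_mul_left {S : H →L[ℂ] H} {f g : ℝ → ℝ} (hf : Continuous f)
    (hg : Continuous g) (h : IsCompactOperator (cfc g S : H →L[ℂ] H)) :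
    IsCompactOperator (cfc (fun s => f s * g s) S : H →L[ℂ] H) := by
  rw [cfc_mul f g S hf.continuousOn hg.continuousOn]
  exact h.clm_comp (cfc f S)

lemma isCompactOperator_cfc_of_sub {S : H →L[ℂ] H} {f g : ℝ → ℝ} (hf : Continuous f)
    (hg : Continuous g) (h : IsCompactOperator (cfc (fun s => f s - g s) S : H →L[ℂ] H))
    (h' : IsCompactOperator (cfc g S : H →L[ℂ] H)) :
    IsCompactOperator (cfc f S : H →L[ℂ] H) := by
  have e : (cfc f S : H →L[ℂ] H) = cfc (fun s => f s - g s) S + cfc g S := by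
    rw [cfc_sub f g S hf.continuousOn hg.continuousOn, sub_add_cancel]
  rw [e]
  exact h.add h'

/-- Functions of `S` supported near a point outside the essential spectrum are compact. -/
lemma exists_isCompactOperator_cfc_of_notMem {S : H →L[ℂ] H} (hS : IsSelfAdjoint S) {t : ℝ}
    (ht : (t : ℂ) ∉ essSpectrum S) :
    ∃ δ > 0, ∀ f : ℝ → ℝ, Continuous f → (∀ s, δ < |t - s| → f s = 0) →
      IsCompactOperator (cfc f S : H →L[ℂ] H) := by
  obtain ⟨B, hB⟩ := exists_compact_parametrix ht
  have hB0 : 0 < ‖B‖ + 1 := by positivity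
  refine ⟨1 / (‖B‖ + 1), by positivity, fun f hf hsupp => ?_⟩
  set δ := 1 / (‖B‖ + 1) with hδ
  have hδ0 : 0 < δ := by positivity
  -- Truncating `t - s` to `[-δ, δ]` changes nothing on the support of `f`, but makes `B * h(S)` a
  -- strict contraction. Hence `1 - B * h(S)` is invertible, and modulo compacts it annihilates
  -- `f(S)`.
  let h : ℝ → ℝ := fun s => max (-δ) (min δ (t - s))
  have hh : Continuous h := by fun_prop
  have hmul : cfc h S * cfc f S = (algebraMap ℂ (H →L[ℂ] H) t - S) * cfc f S := by
    rw [← cfc_const_sub_id hS, ← cfc_mul h f S hh.continuousOn hf.continuousOn,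
      ← cfc_mul (fun s => t - s) f S (by fun_prop) hf.continuousOn]
    congr 1
    ext s
    by_cases hs : δ < |t - s|
    · simp [hsupp s hs]
    · have := abs_le.mp (not_lt.mp hs)
      simp only [h]
      rw [min_eq_right this.2, max_eq_right this.1]
  have hC : ‖B * cfc h S‖ < 1 := by
    have h1 : ‖cfc h S‖ ≤ δ := by
      refine norm_cfc_le hδ0.le fun s _ => ?_
      rw [Real.norm_eq_abs, abs_le]
      exact ⟨le_max_left _ _, max_le (by linarith) (min_le_left _ _)⟩
    calc ‖B * cfc h S‖ ≤ ‖B‖ * δ := (norm_mul_le _ _).trans (by gcongr)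
      _ < 1 := by rw [hδ, mul_one_div, div_lt_one hB0]; linarith
  obtain ⟨D, hD⟩ := (isUnit_one_sub_of_norm_lt_one hC).exists_left_inv
  have key : cfc f S =
      D * -((B * (algebraMap ℂ (H →L[ℂ] H) t - S) - 1) * cfc f S) := by
    calc cfc f S = D * (1 - B * cfc h S) * cfc f S := by rw [hD, one_mul]
      _ = D * (cfc f S - B * (cfc h S * cfc f S)) := by noncomm_ring
      _ = _ := by rw [hmul]; noncomm_ring
  rw [key]
  have h2 : IsCompactOperator ((B * (algebraMap ℂ (H →L[ℂ] H) t - S) - 1) * cfc f S : H →L[ℂ] H) :=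
    hB.comp_clm (cfc f S)
  exact (IsCompactOperator.neg h2).clm_comp D

/-- On the spectrum `s - c` is bounded away from zero, so the operator is invertible; were it
compact, the identity would be compact too. -/
lemma not_isCompactOperator_cfc_posPart {S : H →L[ℂ] H} (hS : IsSelfAdjoint S)
    (hH : ¬ FiniteDimensional ℂ H) {c : ℝ} (hc : c < -‖S‖) :
    ¬ IsCompactOperator (cfc (fun s : ℝ => max (s - c) 0) S : H →L[ℂ] H) := by
  intro h
  have hd : 0 < -‖S‖ - c := by linarith
  have hpos : ∀ s : ℝ, max (s - c) (-‖S‖ - c) ≠ 0 := fun s =>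
    (lt_max_of_lt_right hd).ne'
  have h1 := isCompactOperator_cfc_mul_left (f := fun s : ℝ => (max (s - c) (-‖S‖ - c))⁻¹)
    (Continuous.inv₀ (by fun_prop) hpos) (by fun_prop) h
  rw [cfc_congr (g := fun _ => (1 : ℝ)), cfc_const_one ℝ S] at h1
  · exact hH (FiniteDimensional.of_isCompactOperator_id h1)
  · intro s hs
    have := (abs_le.mp (abs_le_norm_of_mem_spectrum hS hs)).1
    have e1 : max (s - c) (-‖S‖ - c) = s - c := max_eq_left (by linarith)
    have e2 : max (s - c) 0 = s - c := max_eq_left (by linarith)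
    simp only [e1, e2]
    exact inv_mul_cancel₀ (by linarith)

/-- Removing the compact `(S - b)⁺` leaves `min(S, b)`, for which `t - min(S, b)` is invertible. -/
lemma notMem_essSpectrum_of_lt {S : H →L[ℂ] H} (hS : IsSelfAdjoint S) {b t : ℝ}
    (hb : IsCompactOperator (cfc (fun s : ℝ => max (s - b) 0) S : H →L[ℂ] H)) (ht : b < t) :
    (t : ℂ) ∉ essSpectrum S := by
  have hpos : ∀ s : ℝ, t - min s b ≠ 0 := fun s => by
    have := min_le_right s b
    linarith
  have hf : Continuous fun s : ℝ => t - min s b := by fun_prop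
  have hg : Continuous fun s : ℝ => (t - min s b)⁻¹ := hf.inv₀ hpos
  have hsub : S - cfc (fun s : ℝ => min s b) S = cfc (fun s : ℝ => max (s - b) 0) S := by
    nth_rw 1 [← cfc_id' ℝ S]
    rw [← cfc_sub (fun s : ℝ => s) (fun s : ℝ => min s b) S]
    congr 1
    ext s
    rcases le_total s b with h | h
    · rw [min_eq_left h, max_eq_right (by linarith), sub_self]
    · rw [min_eq_right h, max_eq_left (by linarith)]
  rw [essSpectrum_congr (T := cfc (fun s : ℝ => min s b) S) (by rwa [hsub])]
  refine fun h => essSpectrum_subset_spectrum _ h ?_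
  have e : algebraMap ℂ (H →L[ℂ] H) t - cfc (fun s : ℝ => min s b) S
      = cfc (fun s : ℝ => t - min s b) S := by
    rw [cfc_sub (fun _ : ℝ => t) (fun s : ℝ => min s b) S, cfc_const t S]
    rfl
  rw [spectrum.mem_resolventSet_iff, e]
  refine ⟨⟨_, cfc (fun s : ℝ => (t - min s b)⁻¹) S, ?_, ?_⟩, rfl⟩
  · rw [← cfc_mul _ _ S hf.continuousOn hg.continuousOn]
    simp only [mul_inv_cancel₀ (hpos _)]
    exact cfc_const_one ℝ S
  · rw [← cfc_mul _ _ S hg.continuousOn hf.continuousOn]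
    simp only [inv_mul_cancel₀ (hpos _)]
    exact cfc_const_one ℝ S

/-- The largest point of the essential spectrum is the least `b` for which `(S - b)⁺` is compact. -/
lemma exists_isGreatest_essSpectrum {S : H →L[ℂ] H} (hS : IsSelfAdjoint S)
    (hH : ¬ FiniteDimensional ℂ H) :
    ∃ b : ℝ, IsGreatest {t : ℝ | (t : ℂ) ∈ essSpectrum S} b ∧
      IsCompactOperator (cfc (fun s : ℝ => max (s - b) 0) S : H →L[ℂ] H) ∧
      ∀ c < b, ¬ IsCompactOperator (cfc (fun s : ℝ => max (s - c) 0) S : H →L[ℂ] H) := by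
  set G : Set ℝ := {c | IsCompactOperator (cfc (fun s : ℝ => max (s - c) 0) S : H →L[ℂ] H)}
  have hbdd : BddBelow G := ⟨-‖S‖, fun c hc => by
    by_contra h
    exact not_isCompactOperator_cfc_posPart hS hH (not_le.mp h) hc⟩
  have hne : G.Nonempty := by
    refine ⟨‖S‖, ?_⟩
    have : cfc (fun s : ℝ => max (s - ‖S‖) 0) S = 0 := by
      rw [cfc_congr (g := fun _ => (0 : ℝ)), cfc_const_zero]
      intro s hs
      have := (abs_le.mp (abs_le_norm_of_mem_spectrum hS hs)).2
      exact max_eq_right (by linarith)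
    change IsCompactOperator (cfc (fun s : ℝ => max (s - ‖S‖) 0) S : H →L[ℂ] H)
    rw [this]
    exact isCompactOperator_zero
  have hcompact : IsCompactOperator (cfc (fun s : ℝ => max (s - sInf G) 0) S : H →L[ℂ] H) := by
    have hcl := isClosed_setOfPred_isCompactOperator (σ₁₂ := RingHom.id ℂ) (M₁ := H) (M₂ := H)
    -- The infimum is attained: `c ↦ (S - c)⁺` is 1-Lipschitz in norm and the compact operators are
    -- closed.
    refine hcl.closure_subset (Metric.mem_closure_iff.mpr fun ε hε => ?_)
    obtain ⟨c, hc, hlt⟩ := exists_lt_of_csInf_lt hne (show sInf G < sInf G + ε / 2 by linarith)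
    have hle := csInf_le hbdd hc
    refine ⟨_, hc, ?_⟩
    rw [dist_eq_norm, ← cfc_sub (fun s : ℝ => max (s - sInf G) 0) (fun s : ℝ => max (s - c) 0) S]
    refine (norm_cfc_le (c := ε / 2) (by linarith) fun s _ => ?_).trans_lt (by linarith)
    have := abs_max_sub_max_le_abs (s - sInf G) (s - c) 0
    rw [Real.norm_eq_abs]
    refine this.trans ?_
    rw [abs_le]
    constructor <;> linarith
  have hnot : ∀ c < sInf G, ¬ IsCompactOperator (cfc (fun s : ℝ => max (s - c) 0) S : H →L[ℂ] H) :=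
    fun c hc h => (csInf_le hbdd (show c ∈ G from h)).not_gt hc
  refine ⟨sInf G, ⟨?_, fun t ht => ?_⟩, hcompact, hnot⟩
  · by_contra hmem
    obtain ⟨δ, hδ, hf⟩ := exists_isCompactOperator_cfc_of_notMem hS hmem
    set b := sInf G
    refine hnot (b - δ) (by linarith) ?_
    -- `w s * (s - b)⁺` is compact at `S` and equals `(s - (b - δ))⁺` once `|s - b| > δ`. The
    -- difference is supported near `b`, hence compact if `b` is not in the essential spectrum; so
    -- `(S - (b - δ))⁺` would be compact.
    let w : ℝ → ℝ := fun s => (max (s - b) δ)⁻¹ * max (s - (b - δ)) 0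
    have hw : Continuous w := by
      refine Continuous.mul (Continuous.inv₀ (by fun_prop) fun s => ?_) (by fun_prop)
      exact (lt_max_of_lt_right hδ).ne'
    have h1 := isCompactOperator_cfc_mul_left hw (by fun_prop) hcompact
    have h2 := hf (fun s => max (s - (b - δ)) 0 - w s * max (s - b) 0) (by fun_prop) ?_
    · exact isCompactOperator_cfc_of_sub (by fun_prop) (hw.mul (by fun_prop)) h2 h1
    · intro s hs
      rcases lt_abs.mp hs with h | h
      · have e : max (s - (b - δ)) 0 = 0 := max_eq_right (by linarith)
        have e' : max (s - b) 0 = 0 := max_eq_right (by linarith)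
        rw [e, e', mul_zero, sub_zero]
      · have e : max (s - b) δ = s - b := max_eq_left (by linarith)
        have e' : max (s - b) 0 = s - b := max_eq_left (by linarith)
        simp only [w]
        rw [e, e']
        have : s - b ≠ 0 := by linarith
        field_simp
        simp
  · by_contra h
    exact notMem_essSpectrum_of_lt hS hcompact (not_le.mp h) ht

end FunctionalCalculus

/-! ### Traces against projections as sums over orthonormal families. -/

section Trace

variable {H : Type*} [NormedAddCommGroup H] [InnerProductSpace ℂ H]

instance finiteDimensional_span_range {ι : Type*} [Finite ι] (e : ι → H) :
    FiniteDimensional ℂ (Submodule.span ℂ (Set.range e)) :=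
  FiniteDimensional.span_of_finite ℂ (Set.finite_range e)

lemma starProjection_span_range {k : ℕ} {e : Fin k → H} (he : Orthonormal ℂ e) (x : H) :
    (Submodule.span ℂ (Set.range e)).starProjection x = ∑ i, inner ℂ (e i) x • e i := by
  refine Submodule.eq_starProjection_of_mem_of_inner_eq_zero
    (Submodule.sum_mem _ fun i _ => Submodule.smul_mem _ _ (Submodule.subset_span ⟨i, rfl⟩)) ?_
  intro w hw
  induction hw using Submodule.span_induction with
  | mem w hw =>
    obtain ⟨j, rfl⟩ := hw
    rw [inner_sub_left, sum_inner]
    simp_rw [inner_smul_left]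
    rw [Finset.sum_eq_single j]
    · simp [inner_self_eq_norm_sq_to_K, he.1 j]
    · intro i _ hij
      rw [he.2 hij, mul_zero]
    · simp
  | zero => simp
  | add x y _ _ hx hy => rw [inner_add_right, hx, hy, add_zero]
  | smul a x _ hx => rw [inner_smul_right, hx, mul_zero]

lemma re_inner_apply_le (T : H →L[ℂ] H) {x : H} (hx : ‖x‖ = 1) :
    (inner ℂ x (T x)).re ≤ ‖T‖ := by
  refine (Complex.re_le_norm _).trans ((norm_inner_le_norm _ _).trans ?_)
  have := T.le_opNorm x
  rw [hx, mul_one] at this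
  rwa [hx, one_mul]

lemma exists_orthonormal_of_not_finiteDimensional {N : Submodule ℂ H}
    (hN : ¬ FiniteDimensional ℂ N) (k : ℕ) :
    ∃ f : Fin k → H, Orthonormal ℂ f ∧ ∀ i, f i ∈ N := by
  have hk : (k : Cardinal) ≤ Module.rank ℂ N := by
    have h := mt Module.rank_lt_aleph0_iff.mp hN
    exact Cardinal.natCast_le_aleph0.trans (not_lt.mp h)
  obtain ⟨v, hv⟩ := Module.le_rank_iff_exists_linearMap.mp hk
  have hli : LinearIndependent ℂ fun i => v (Pi.basisFun ℂ (Fin k) i) :=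
    (Pi.basisFun ℂ (Fin k)).linearIndependent.map' v (LinearMap.ker_eq_bot.mpr hv)
  have ho := InnerProductSpace.gramSchmidtNormed_orthonormal hli
  exact ⟨_, ho.comp_linearIsometry N.subtypeₗᵢ, fun i => Subtype.property _⟩

/-- A compact operator has averaged partial traces tending to zero, uniformly in the
orthonormal family. -/
lemma exists_sum_re_inner_le {K : H →L[ℂ] H} (hK : IsCompactOperator K) {ε : ℝ} (hε : 0 < ε) :
    ∃ C : ℝ, ∀ (k : ℕ) (e : Fin k → H), Orthonormal ℂ e →
      ∑ i, (inner ℂ (e i) (K (e i))).re ≤ ε * k + C * √k := by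
  -- Each `K (e i)` is within `ε` of a finite net `s`. Against a fixed `y ∈ s`, Cauchy-Schwarz and
  -- Bessel bound `∑ ‖⟨e i, y⟩‖` by `‖y‖ * √k`.
  obtain ⟨s, hs, hcov⟩ := Metric.totallyBounded_iff.mp
    (hK.isCompact_closure_image_closedBall 1).totallyBounded ε hε
  lift s to Finset H using hs
  refine ⟨∑ y ∈ s, ‖y‖, fun k e he => ?_⟩
  have h1 : ∀ i, (inner ℂ (e i) (K (e i))).re ≤ ε + ∑ y ∈ s, ‖inner ℂ (e i) y‖ := by
    intro i
    have hmem : K (e i) ∈ closure (K '' Metric.closedBall 0 1) :=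
      subset_closure ⟨e i, by simp [he.1 i], rfl⟩
    obtain ⟨y, hy, hball⟩ := Set.mem_iUnion₂.mp (hcov hmem)
    rw [Metric.mem_ball, dist_eq_norm] at hball
    have h2 : inner ℂ (e i) (K (e i)) = inner ℂ (e i) (K (e i) - y) + inner ℂ (e i) y := by
      rw [← inner_add_right, sub_add_cancel]
    rw [h2, Complex.add_re]
    refine add_le_add ((Complex.re_le_norm _).trans ((norm_inner_le_norm _ _).trans ?_))
      ((Complex.re_le_norm _).trans
        (Finset.single_le_sum (f := fun y => ‖inner ℂ (e i) y‖) (fun _ _ => norm_nonneg _) hy))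
    rw [he.1 i, one_mul]
    exact hball.le
  refine (Finset.sum_le_sum fun i _ => h1 i).trans ?_
  rw [Finset.sum_add_distrib, Finset.sum_comm, Finset.sum_mul]
  refine add_le_add (by simp [mul_comm]) (Finset.sum_le_sum fun y _ => ?_)
  refine abs_le_of_sq_le_sq' ?_ (by positivity) |>.2
  calc (∑ i, ‖inner ℂ (e i) y‖) ^ 2 ≤ k * ∑ i, ‖inner ℂ (e i) y‖ ^ 2 := by
        simpa using sq_sum_le_card_mul_sum_sq (s := Finset.univ) (f := fun i => ‖inner ℂ (e i) y‖)
    _ ≤ k * ‖y‖ ^ 2 := by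
        gcongr
        exact he.sum_inner_products_le y
    _ = (‖y‖ * √k) ^ 2 := by rw [mul_pow, Real.sq_sqrt (Nat.cast_nonneg k), mul_comm]

variable [CompleteSpace H]

/-- Parseval for each `e i` in the chosen Hilbert basis; this removes the dependence of `opTrace` on
that choice. -/
lemma opTrace_mul_starProjection {k : ℕ} {e : Fin k → H} (he : Orthonormal ℂ e) (T : H →L[ℂ] H) :
    opTrace (T * (Submodule.span ℂ (Set.range e)).starProjection)
      = ∑ i, inner ℂ (e i) (T (e i)) := by
  unfold opTrace
  set b := (exists_hilbertBasis ℂ H).choose_spec.choose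
  refine HasSum.tsum_eq ?_
  have h : HasSum (fun j => ∑ i, inner ℂ (e i) (b j) * inner ℂ (b j) (T (e i)))
      (∑ i, inner ℂ (e i) (T (e i))) :=
    hasSum_sum fun i _ => b.hasSum_inner_mul_inner (e i) (T (e i))
  convert h using 2 with j
  rw [mul_apply_eq_comp, starProjection_span_range he, map_sum, inner_sum]
  simp_rw [map_smul, inner_smul_right]

lemma starProjection_span_mem_projections {k : ℕ} {e : Fin k → H} (he : Orthonormal ℂ e) :
    (Submodule.span ℂ (Set.range e)).starProjection ∈ projections H k := by
  refine ⟨isStarProjection_starProjection, ?_⟩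
  have h := Submodule.range_starProjection (Submodule.span ℂ (Set.range e))
  have h2 := finrank_span_eq_card he.linearIndependent
  rw [Fintype.card_fin] at h2
  refine (congrArg (fun W : Submodule ℂ H => Module.rank ℂ W) h).trans ?_
  rw [← Module.finrank_eq_rank, h2]

lemma exists_orthonormal_of_mem_projections {k : ℕ} {P : H →L[ℂ] H} (hP : P ∈ projections H k) :
    ∃ e : Fin k → H, Orthonormal ℂ e ∧ P = (Submodule.span ℂ (Set.range e)).starProjection := by
  obtain ⟨h1, h2⟩ := hP
  obtain ⟨_, h3⟩ := isStarProjection_iff_eq_starProjection_range.mp h1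
  set W := LinearMap.range P.toLinearMap
  have : FiniteDimensional ℂ W := Module.finite_of_rank_eq_nat h2
  have hk : Module.finrank ℂ W = k := Module.finrank_eq_of_rank_eq h2
  let b := (stdOrthonormalBasis ℂ W).reindex (finCongr hk)
  have hspan : Submodule.span ℂ (Set.range fun i => (b i : H)) = W := by
    have h4 : Set.range (fun i => (b i : H)) = W.subtype '' Set.range b := by
      rw [← Set.range_comp]
      rfl
    rw [h4, Submodule.span_image, ← b.coe_toBasis, b.toBasis.span_eq, Submodule.map_top,
      Submodule.range_subtype]
  refine ⟨fun i => b i, b.orthonormal.comp_linearIsometry W.subtypeₗᵢ, ?_⟩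
  simp_rw [hspan]
  exact h3

lemma setOf_re_opTrace_eq (k : ℕ) (T : H →L[ℂ] H) :
    {r : ℝ | ∃ P ∈ projections H k, r = (opTrace (T * P)).re} =
      {r : ℝ | ∃ e : Fin k → H, Orthonormal ℂ e ∧ r = ∑ i, (inner ℂ (e i) (T (e i))).re} := by
  ext r
  constructor
  · rintro ⟨P, hP, rfl⟩
    obtain ⟨e, he, rfl⟩ := exists_orthonormal_of_mem_projections hP
    exact ⟨e, he, by rw [opTrace_mul_starProjection he, Complex.re_sum]⟩
  · rintro ⟨e, he, rfl⟩
    exact ⟨_, starProjection_span_mem_projections he, by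
      rw [opTrace_mul_starProjection he, Complex.re_sum]⟩

lemma sum_re_inner_le_upperSum {k : ℕ} (T : H →L[ℂ] H) {e : Fin k → H} (he : Orthonormal ℂ e) :
    ∑ i, (inner ℂ (e i) (T (e i))).re ≤ upperSum k T := by
  unfold upperSum
  rw [setOf_re_opTrace_eq]
  refine le_csSup ⟨k * ‖T‖, ?_⟩ ⟨e, he, rfl⟩
  rintro r ⟨e, he, rfl⟩
  refine (Finset.sum_le_sum fun i _ => re_inner_apply_le T (he.1 i)).trans ?_
  simp

/-- Infinite dimension ensures that orthonormal `k`-families exist; otherwise the supremum would be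
the default value `0`. -/
lemma upperSum_le (hH : ¬ FiniteDimensional ℂ H) {k : ℕ} {T : H →L[ℂ] H} {c : ℝ}
    (h : ∀ e : Fin k → H, Orthonormal ℂ e → ∑ i, (inner ℂ (e i) (T (e i))).re ≤ c) :
    upperSum k T ≤ c := by
  unfold upperSum
  rw [setOf_re_opTrace_eq]
  refine csSup_le ?_ ?_
  · have : ¬ FiniteDimensional ℂ (⊤ : Submodule ℂ H) := fun h =>
      hH (Module.finite_def.mpr (Module.Finite.iff_fg.mp h))
    obtain ⟨e, he, -⟩ := exists_orthonormal_of_not_finiteDimensional this k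
    exact ⟨_, e, he, rfl⟩
  · rintro r ⟨e, he, rfl⟩
    exact h e he

lemma lowerSum_eq_neg_upperSum (k : ℕ) (T : H →L[ℂ] H) : lowerSum k T = -upperSum k (-T) := by
  unfold lowerSum upperSum
  rw [setOf_re_opTrace_eq, setOf_re_opTrace_eq, ← Real.sInf_neg]
  congr 1
  ext r
  simp [neg_eq_iff_eq_neg]

lemma tendsto_upperSum_div_of_isCompactOperator (hH : ¬ FiniteDimensional ℂ H) {K : H →L[ℂ] H}
    (hK : IsCompactOperator K) (hpos : K.IsPositive) :
    Tendsto (fun k : ℕ => upperSum k K / k) atTop (𝓝 0) := by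
  have hnonneg : ∀ k : ℕ, 0 ≤ upperSum k K / k := by
    intro k
    have : ¬ FiniteDimensional ℂ (⊤ : Submodule ℂ H) := fun h =>
      hH (Module.finite_def.mpr (Module.Finite.iff_fg.mp h))
    obtain ⟨e, he, -⟩ := exists_orthonormal_of_not_finiteDimensional this k
    refine div_nonneg ((Finset.sum_nonneg fun i _ => ?_).trans (sum_re_inner_le_upperSum K he))
      (Nat.cast_nonneg k)
    exact hpos.re_inner_nonneg_right (e i)
  rw [Metric.tendsto_atTop]
  intro ε hε
  obtain ⟨C, hC⟩ := exists_sum_re_inner_le hK (half_pos hε)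
  have hlim : Tendsto (fun k : ℕ => ε / 2 + C / √k) atTop (𝓝 (ε / 2 + 0)) :=
    tendsto_const_nhds.add (tendsto_const_nhds.div_atTop
      (Real.tendsto_sqrt_atTop.comp tendsto_natCast_atTop_atTop))
  have hev := hlim.eventually (gt_mem_nhds (show ε / 2 + 0 < ε by linarith))
  obtain ⟨N, hN⟩ := eventually_atTop.mp (hev.and (eventually_gt_atTop 0))
  refine ⟨N, fun k hk => ?_⟩
  obtain ⟨h1, h2⟩ := hN k hk
  rw [Real.dist_eq, sub_zero, abs_of_nonneg (hnonneg k)]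
  refine lt_of_le_of_lt ?_ h1
  have hk0 : (0 : ℝ) < k := by exact_mod_cast h2
  rw [div_le_iff₀ hk0]
  refine (upperSum_le hH (hC k)).trans (le_of_eq ?_)
  have hsq : √(k : ℝ) ≠ 0 := (Real.sqrt_pos.mpr hk0).ne'
  have : C / √(k : ℝ) * k = C * √k := by
    rw [div_mul_eq_mul_div, div_eq_iff hsq, mul_assoc, Real.mul_self_sqrt hk0.le]
  rw [add_mul, this]

end Trace

/-! ### Moving orthonormal families into subspaces where `S` is large. -/

section UpperSum

variable {H : Type*} [NormedAddCommGroup H] [InnerProductSpace ℂ H]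

/-- The projection onto `F`, restricted to `N`, has finite rank, and its kernel embeds in `N ⊓ Fᗮ`.
-/
lemma not_finiteDimensional_inf_orthogonal {N F : Submodule ℂ H} [FiniteDimensional ℂ F]
    (hN : ¬ FiniteDimensional ℂ N) : ¬ FiniteDimensional ℂ (N ⊓ Fᗮ : Submodule ℂ H) := by
  intro h
  let φ : N →ₗ[ℂ] F := (F.orthogonalProjectionOnto : H →ₗ[ℂ] F) ∘ₗ N.subtype
  have hker : FiniteDimensional ℂ (LinearMap.ker φ) := by
    let ψ : LinearMap.ker φ →ₗ[ℂ] (N ⊓ Fᗮ : Submodule ℂ H) :=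
      LinearMap.codRestrict _ (N.subtype ∘ₗ (LinearMap.ker φ).subtype) fun x =>
        ⟨x.1.2, F.orthogonalProjectionOnto_eq_zero_iff.mp x.2⟩
    refine FiniteDimensional.of_injective ψ fun x y hxy => ?_
    have h1 : ((ψ x : _) : H) = ((ψ y : _) : H) := by rw [hxy]
    exact Subtype.ext (Subtype.ext h1)
  have hquot : FiniteDimensional ℂ (N ⧸ LinearMap.ker φ) :=
    φ.quotKerEquivRange.symm.finiteDimensional
  exact hN (Module.Finite.of_submodule_quotient (LinearMap.ker φ))

lemma exists_linearIsometry_mem (V : Submodule ℂ H) [FiniteDimensional ℂ V] {N : Submodule ℂ H}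
    (hN : ¬ FiniteDimensional ℂ N) : ∃ J : V →ₗᵢ[ℂ] H, ∀ x, J x ∈ N := by
  obtain ⟨f, hf, hfN⟩ := exists_orthonormal_of_not_finiteDimensional hN (Module.finrank ℂ V)
  let b := stdOrthonormalBasis ℂ V
  have hcomp : (b.toBasis.constr ℂ f : V →ₗ[ℂ] H) ∘ b.toBasis = f := by
    ext i
    simp
  refine ⟨LinearMap.isometryOfOrthonormal (v := b.toBasis) (b.toBasis.constr ℂ f)
    (by simp) (by rw [hcomp]; exact hf), fun x => ?_⟩
  change b.toBasis.constr ℂ f x ∈ N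
  rw [Module.Basis.constr_apply_fintype]
  exact Submodule.sum_mem _ fun i _ => Submodule.smul_mem _ _ (hfN i)

lemma not_finiteDimensional_range {A : H →L[ℂ] H} (hA : ¬ IsCompactOperator A) :
    ¬ FiniteDimensional ℂ (LinearMap.range A.toLinearMap) := by
  intro h
  let A' : H →L[ℂ] LinearMap.range A.toLinearMap :=
    A.codRestrict _ fun x => ⟨x, rfl⟩
  have hA' : IsCompactOperator A' := by
    have := FiniteDimensional.proper ℂ (LinearMap.range A.toLinearMap)
    exact isCompactOperator_of_locallyCompactSpace_dom A'
  exact hA (hA'.clm_comp (LinearMap.range A.toLinearMap).subtypeL)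

variable [CompleteSpace H]

lemma re_inner_cfc_mono (S : H →L[ℂ] H) {f g : ℝ → ℝ} (hf : Continuous f) (hg : Continuous g)
    (h : ∀ s, f s ≤ g s) (x : H) :
    (inner ℂ x ((cfc f S : H →L[ℂ] H) x)).re ≤ (inner ℂ x ((cfc g S : H →L[ℂ] H) x)).re := by
  have h1 : (cfc f S : H →L[ℂ] H) ≤ cfc g S :=
    cfc_mono (fun s _ => h s) hf.continuousOn hg.continuousOn
  have h2 := ((ContinuousLinearMap.le_def _ _).mp h1).re_inner_nonneg_right x
  rw [_root_.sub_apply, inner_sub_right, map_sub] at h2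
  exact sub_nonneg.mp h2

lemma inner_cfc_cfc {S : H →L[ℂ] H} {f g : ℝ → ℝ} (hf : Continuous f) (hg : Continuous g)
    (x y : H) :
    inner ℂ ((cfc f S : H →L[ℂ] H) x) ((cfc g S : H →L[ℂ] H) y)
      = inner ℂ x ((cfc (fun s => f s * g s) S : H →L[ℂ] H) y) := by
  have hsa : IsSelfAdjoint (cfc f S : H →L[ℂ] H) := cfc_predicate f S
  rw [cfc_mul f g S hf.continuousOn hg.continuousOn, mul_apply_eq_comp,
    ← ContinuousLinearMap.adjoint_inner_left (cfc f S), hsa.adjoint_eq]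

lemma cfc_add_const_mul_apply {S : H →L[ℂ] H} (hS : IsSelfAdjoint S) {f : ℝ → ℝ}
    (hf : Continuous f) (c : ℝ) (x : H) :
    (inner ℂ x ((cfc (fun s => f s + c) S : H →L[ℂ] H) x)).re
      = (inner ℂ x ((cfc f S : H →L[ℂ] H) x)).re + c * ‖x‖ ^ 2 := by
  rw [cfc_add (a := S) f (fun _ => c) hf.continuousOn, cfc_const c S,
    _root_.add_apply, inner_add_right, Complex.add_re]
  congr 1
  change (inner ℂ x ((c : ℂ) • x)).re = _
  rw [inner_smul_right, Complex.re_ofReal_mul, inner_self_eq_norm_sq_to_K]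
  norm_cast

/-- If `(S - c)⁺` is not compact, then `S ≥ c` on an infinite-dimensional subspace. -/
lemma exists_submodule_le_re_inner {S : H →L[ℂ] H} (hS : IsSelfAdjoint S) {c : ℝ}
    (hc : ¬ IsCompactOperator (cfc (fun s : ℝ => max (s - c) 0) S : H →L[ℂ] H)) :
    ∃ N : Submodule ℂ H, ¬ FiniteDimensional ℂ N ∧
      ∀ x ∈ N, c * ‖x‖ ^ 2 ≤ (inner ℂ x (S x)).re := by
  -- The range of `p(S) = (S - c)⁺` serves as the subspace; on `p(S) y` the claim becomes the
  -- pointwise inequality `c * p² ≤ s * p²`.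
  refine ⟨_, not_finiteDimensional_range hc, ?_⟩
  rintro _ ⟨y, rfl⟩
  set p : ℝ → ℝ := fun s => max (s - c) 0
  have hpc : Continuous p := by fun_prop
  change c * ‖(cfc p S : H →L[ℂ] H) y‖ ^ 2 ≤
    (inner ℂ ((cfc p S : H →L[ℂ] H) y) (S ((cfc p S : H →L[ℂ] H) y))).re
  have e1 : S ((cfc p S : H →L[ℂ] H) y) = (cfc (fun s => s * p s) S : H →L[ℂ] H) y := by
    rw [cfc_mul (fun s => s) p S (by fun_prop) hpc.continuousOn, cfc_id' ℝ S]
    rfl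
  have e2 : c * ‖(cfc p S : H →L[ℂ] H) y‖ ^ 2
      = (inner ℂ ((cfc p S : H →L[ℂ] H) y) ((cfc (fun s => c * p s) S : H →L[ℂ] H) y)).re := by
    rw [cfc_const_mul c p S hpc.continuousOn]
    change _ = (inner ℂ _ ((c : ℂ) • (cfc p S : H →L[ℂ] H) y)).re
    rw [inner_smul_right, Complex.re_ofReal_mul, inner_self_eq_norm_sq_to_K]
    norm_cast
  rw [e1, e2, inner_cfc_cfc hpc (by fun_prop), inner_cfc_cfc hpc (by fun_prop)]
  refine re_inner_cfc_mono S (by fun_prop) (by fun_prop) (fun s => ?_) y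
  rcases le_total s c with h | h
  · simp [p, max_eq_right (sub_nonpos.mpr h)]
  · have : 0 ≤ p s := le_max_right _ _
    gcongr

/-- An orthonormal family can be moved so as to replace the part of `S` below `a` by `a`, up to
an arbitrarily small loss, provided `(S - a + ε)⁺` is not compact. -/
lemma exists_orthonormal_posPart_le {S : H →L[ℂ] H} (hS : IsSelfAdjoint S) {a ε : ℝ} (hε : 0 < ε)
    (hc : ¬ IsCompactOperator (cfc (fun s : ℝ => max (s - (a - ε)) 0) S : H →L[ℂ] H))
    {k : ℕ} {e : Fin k → H} (he : Orthonormal ℂ e) :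
    ∃ e' : Fin k → H, Orthonormal ℂ e' ∧ ∀ i,
      (inner ℂ (e i) ((cfc (fun s : ℝ => max (s - a) 0) S : H →L[ℂ] H) (e i))).re + (a - 2 * ε)
        ≤ (inner ℂ (e' i) (S (e' i))).re := by
  obtain ⟨N, hN, hNS⟩ := exists_submodule_le_re_inner hS hc
  -- A continuous substitute for the spectral projection above `a`: `g` rises from 0 to 1 on `[a, a
  -- + ε]`, and `g² + h² = 1` splits each vector isometrically.
  let g : ℝ → ℝ := fun s => max 0 (min 1 ((s - a) / ε))
  let h : ℝ → ℝ := fun s => √(1 - g s ^ 2)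
  have hg : Continuous g := by fun_prop
  have hh : Continuous h := by fun_prop
  have hg0 : ∀ s, 0 ≤ g s := fun s => le_max_left _ _
  have hg1 : ∀ s, g s ≤ 1 := fun s => max_le zero_le_one (min_le_left _ _)
  have hgh : ∀ s, h s * h s = 1 - g s ^ 2 := fun s =>
    Real.mul_self_sqrt (by nlinarith [hg0 s, hg1 s])
  let G : H →L[ℂ] H := cfc g S
  let D : H →L[ℂ] H := cfc h S
  let V : Submodule ℂ H := Submodule.span ℂ (Set.range fun i => D (e i))
  let F₁ : Submodule ℂ H := Submodule.span ℂ (Set.range fun i => G (e i))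
  let F₂ : Submodule ℂ H := Submodule.span ℂ (Set.range fun i => S (G (e i)))
  -- Orthogonality to `F₁` keeps the new family orthonormal; orthogonality to `F₂` kills the cross
  -- terms in its quadratic form.
  obtain ⟨J, hJ⟩ := exists_linearIsometry_mem V
    (not_finiteDimensional_inf_orthogonal (F := F₁ ⊔ F₂) hN)
  let d : Fin k → V := fun i => ⟨D (e i), Submodule.subset_span ⟨i, rfl⟩⟩
  have hG : ∀ i j, inner ℂ (G (e i)) (J (d j)) = 0 := fun i j =>
    (hJ (d j)).2 _ (le_sup_left (a := F₁) (Submodule.subset_span ⟨i, rfl⟩))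
  have hSG : ∀ i j, inner ℂ (S (G (e i))) (J (d j)) = 0 := fun i j =>
    (hJ (d j)).2 _ (le_sup_right (a := F₁) (Submodule.subset_span ⟨i, rfl⟩))
  have hJJ : ∀ i j, inner ℂ (J (d i)) (J (d j)) = inner ℂ (D (e i)) (D (e j)) := fun i j =>
    J.inner_map_map _ _
  refine ⟨fun i => G (e i) + J (d i), ?_, fun i => ?_⟩
  · rw [orthonormal_iff_ite] at he ⊢
    intro i j
    rw [← he i j, inner_add_left, inner_add_right, inner_add_right, hG, hJJ,
      inner_eq_zero_symm.mp (hG j i), add_zero, zero_add]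
    simp only [G, D]
    rw [inner_cfc_cfc hg hg, inner_cfc_cfc hh hh, ← inner_add_right,
      ← _root_.add_apply,
      ← cfc_add (a := S) (fun s => g s * g s) (fun s => h s * h s) (hg.mul hg).continuousOn
        (hh.mul hh).continuousOn]
    simp_rw [hgh]
    have : (fun s => g s * g s + (1 - g s ^ 2)) = fun _ => (1 : ℝ) := by
      ext s
      ring
    rw [this, cfc_const_one ℝ S]
    rfl
  · have hsym : inner ℂ (G (e i)) (S (J (d i))) = 0 := by
      rw [← ContinuousLinearMap.adjoint_inner_left, hS.adjoint_eq]
      exact hSG i i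
    rw [map_add, inner_add_left, inner_add_right, inner_add_right, hsym,
      inner_eq_zero_symm.mp (hSG i i), add_zero, zero_add, Complex.add_re]
    have hJN := hNS _ (hJ (d i)).1
    have hnorm : ‖J (d i)‖ ^ 2 = (inner ℂ (D (e i)) (D (e i))).re := by
      rw [J.norm_map, inner_self_eq_norm_sq_to_K]
      norm_cast
    rw [hnorm] at hJN
    refine le_trans ?_ (add_le_add_right hJN _)
    simp only [D]
    have e1 : S (G (e i)) = (cfc (fun s => s * g s) S : H →L[ℂ] H) (e i) := by
      rw [cfc_mul (fun s => s) g S (by fun_prop) hg.continuousOn, cfc_id' ℝ S]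
      rfl
    rw [e1, inner_cfc_cfc hh hh]
    simp only [G]
    rw [inner_cfc_cfc hg (by fun_prop)]
    have hone : ‖e i‖ ^ 2 = 1 := by rw [he.1 i, one_pow]
    have e2 : (a - ε) * (inner ℂ (e i) ((cfc (fun s => h s * h s) S : H →L[ℂ] H) (e i))).re
        = (inner ℂ (e i)
          ((cfc (fun s => (a - ε) * (h s * h s)) S : H →L[ℂ] H) (e i))).re := by
      rw [cfc_const_mul (a - ε) _ S (by fun_prop)]
      change _ = (inner ℂ (e i) (((a - ε : ℝ) : ℂ) •
        (cfc (fun s => h s * h s) S : H →L[ℂ] H) (e i))).re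
      rw [inner_smul_right, Complex.re_ofReal_mul]
    have e3 := cfc_add_const_mul_apply hS (f := fun s : ℝ => max (s - a) 0) (by fun_prop)
      (a - 2 * ε) (e i)
    rw [hone, mul_one] at e3
    rw [e2, ← e3, ← Complex.add_re, ← inner_add_right, ← _root_.add_apply,
      ← cfc_add (a := S) _ _ (by fun_prop) (by fun_prop)]
    -- What remains is `(s - a)⁺ + a - 2ε ≤ s * g² + (a - ε) * (1 - g²)`, checked below `a`, on the
    -- ramp and above `a + ε`.
    refine re_inner_cfc_mono S (by fun_prop) (by fun_prop) (fun s => ?_) (e i)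
    rw [hgh]
    rcases le_total s a with hs | hs
    · have : g s = 0 := max_eq_left ((min_le_right _ _).trans
        (div_nonpos_of_nonpos_of_nonneg (by linarith) hε.le))
      rw [this, max_eq_right (by linarith)]
      linarith
    · rw [max_eq_left (by linarith)]
      rcases le_total s (a + ε) with hs' | hs'
      · nlinarith [mul_nonneg (mul_nonneg (hg0 s) (hg0 s)) (show 0 ≤ s - a + ε by linarith)]
      · have : g s = 1 := by
          have h1 : 1 ≤ (s - a) / ε := by rw [le_div_iff₀ hε]; linarith
          simp only [g]
          rw [min_eq_left h1, max_eq_right zero_le_one]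
        rw [this]
        linarith

end UpperSum

/-! ### The operators S⁺ and S₋, the trace formulas and the essential norm. -/

section Parts

variable {H : Type*} [NormedAddCommGroup H] [InnerProductSpace ℂ H]

lemma setOf_mem_essSpectrum_eq_neg (S : H →L[ℂ] H) :
    {t : ℝ | (t : ℂ) ∈ essSpectrum S} = -{t : ℝ | (t : ℂ) ∈ essSpectrum (-S)} := by
  ext t
  simp [essSpectrum_neg]

lemma alphaMinus_eq_neg_alphaPlus (S : H →L[ℂ] H) : alphaMinus S = -alphaPlus (-S) := by
  unfold alphaMinus alphaPlus
  rw [setOf_mem_essSpectrum_eq_neg, Real.sInf_neg]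

variable [CompleteSpace H]

/-- The cut-off at `‖S‖` is invisible on the spectrum; the right-hand function is continuous on all
of ℝ, as the preceding lemmas require. -/
lemma plusPart_eq_cfc {S : H →L[ℂ] H} (hS : IsSelfAdjoint S) :
    plusPart S = cfc (fun s : ℝ => max (s - alphaPlus S) 0) S := by
  refine cfc_congr fun s hs => ?_
  have h := (abs_le.mp (abs_le_norm_of_mem_spectrum hS hs)).2
  by_cases hs' : alphaPlus S ≤ s
  · rw [Set.indicator_of_mem (Set.mem_Icc.mpr ⟨hs', h⟩), max_eq_left (by linarith)]
  · rw [Set.indicator_of_notMem (fun hm => hs' hm.1), max_eq_right (by linarith)]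

lemma minusPart_eq_cfc {S : H →L[ℂ] H} (hS : IsSelfAdjoint S) :
    minusPart S = cfc (fun s : ℝ => min (s - alphaMinus S) 0) S := by
  refine cfc_congr fun s hs => ?_
  have h := (abs_le.mp (abs_le_norm_of_mem_spectrum hS hs)).1
  by_cases hs' : s ≤ alphaMinus S
  · rw [Set.indicator_of_mem (Set.mem_Icc.mpr ⟨h, hs'⟩), min_eq_left (by linarith)]
  · rw [Set.indicator_of_notMem (fun hm => hs' hm.2), min_eq_right (by linarith)]

lemma minusPart_eq_neg_plusPart {S : H →L[ℂ] H} (hS : IsSelfAdjoint S) :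
    minusPart S = -plusPart (-S) := by
  rw [minusPart_eq_cfc hS, plusPart_eq_cfc hS.neg, alphaMinus_eq_neg_alphaPlus,
    ← cfc_comp_neg (fun s : ℝ => max (s - alphaPlus (-S)) 0) S, ← cfc_neg]
  congr 1
  ext s
  rw [← min_neg_neg, neg_zero]
  congr 1
  ring

lemma isGreatest_alphaPlus {S : H →L[ℂ] H} (hS : IsSelfAdjoint S)
    (hH : ¬ FiniteDimensional ℂ H) :
    IsGreatest {t : ℝ | (t : ℂ) ∈ essSpectrum S} (alphaPlus S) := by
  obtain ⟨b, hb, -⟩ := exists_isGreatest_essSpectrum hS hH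
  rwa [alphaPlus, hb.csSup_eq]

lemma isCompactOperator_plusPart {S : H →L[ℂ] H} (hS : IsSelfAdjoint S)
    (hH : ¬ FiniteDimensional ℂ H) : IsCompactOperator (plusPart S) := by
  obtain ⟨b, hb, hc, -⟩ := exists_isGreatest_essSpectrum hS hH
  rwa [plusPart_eq_cfc hS, alphaPlus, hb.csSup_eq]

lemma not_isCompactOperator_of_lt_alphaPlus {S : H →L[ℂ] H} (hS : IsSelfAdjoint S)
    (hH : ¬ FiniteDimensional ℂ H) {c : ℝ} (hc : c < alphaPlus S) :
    ¬ IsCompactOperator (cfc (fun s : ℝ => max (s - c) 0) S : H →L[ℂ] H) := by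
  obtain ⟨b, hb, -, h⟩ := exists_isGreatest_essSpectrum hS hH
  rw [alphaPlus, hb.csSup_eq] at hc
  exact h c hc

lemma isPositive_plusPart {S : H →L[ℂ] H} (hS : IsSelfAdjoint S) : (plusPart S).IsPositive := by
  rw [plusPart_eq_cfc hS, ← ContinuousLinearMap.nonneg_iff_isPositive]
  exact cfc_nonneg fun s _ => le_max_right _ _

lemma upperSum_eq_upperSum_plusPart_add {S : H →L[ℂ] H} (hS : IsSelfAdjoint S)
    (hH : ¬ FiniteDimensional ℂ H) (k : ℕ) :
    upperSum k S = upperSum k (plusPart S) + k * alphaPlus S := by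
  refine le_antisymm (upperSum_le hH fun e he => ?_) ?_
  · refine le_trans ?_ (add_le_add_left (sum_re_inner_le_upperSum (plusPart S) he) _)
    have hk : (k : ℝ) * alphaPlus S = ∑ _i : Fin k, alphaPlus S := by simp
    rw [hk, ← Finset.sum_add_distrib]
    refine Finset.sum_le_sum fun i _ => ?_
    have h := cfc_add_const_mul_apply hS (f := fun s : ℝ => max (s - alphaPlus S) 0)
      (by fun_prop) (alphaPlus S) (e i)
    rw [he.1 i, one_pow, mul_one] at h
    rw [plusPart_eq_cfc hS, ← h]
    nth_rw 1 [← cfc_id' ℝ S]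
    refine re_inner_cfc_mono S (by fun_prop) (by fun_prop) (fun s => ?_) (e i)
    linarith [le_max_left (s - alphaPlus S) 0]
  · rw [← le_sub_iff_add_le]
    refine upperSum_le hH fun e he => ?_
    refine le_of_forall_pos_le_add fun δ hδ => ?_
    -- The total loss is `2 * ε * k ≤ δ`; `k + 1` avoids division by zero at `k = 0`.
    set ε := δ / (2 * (k + 1)) with hε
    have hε0 : 0 < ε := by positivity
    obtain ⟨e', he', h⟩ := exists_orthonormal_posPart_le hS hε0
      (not_isCompactOperator_of_lt_alphaPlus hS hH (sub_lt_self _ hε0)) he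
    have h1 := (Finset.sum_le_sum fun i (_ : i ∈ Finset.univ) => h i).trans
      (sum_re_inner_le_upperSum S he')
    rw [Finset.sum_add_distrib, ← plusPart_eq_cfc hS] at h1
    simp only [Finset.sum_const, Finset.card_univ, Fintype.card_fin, nsmul_eq_mul] at h1
    have h2 : (k : ℝ) * (2 * ε) ≤ δ := by
      rw [hε]
      field_simp
      linarith
    linarith

lemma tendsto_upperSum_div {S : H →L[ℂ] H} (hS : IsSelfAdjoint S)
    (hH : ¬ FiniteDimensional ℂ H) :
    Tendsto (fun k : ℕ => upperSum k S / k) atTop (𝓝 (alphaPlus S)) := by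
  have h := (tendsto_upperSum_div_of_isCompactOperator hH (isCompactOperator_plusPart hS hH)
    (isPositive_plusPart hS)).add_const (alphaPlus S)
  rw [zero_add] at h
  refine h.congr' ?_
  filter_upwards [eventually_gt_atTop 0] with k hk
  have hk0 : (k : ℝ) ≠ 0 := by exact_mod_cast hk.ne'
  rw [upperSum_eq_upperSum_plusPart_add hS hH, add_div, mul_div_cancel_left₀ _ hk0]

lemma isLeast_alphaMinus {S : H →L[ℂ] H} (hS : IsSelfAdjoint S)
    (hH : ¬ FiniteDimensional ℂ H) :
    IsLeast {t : ℝ | (t : ℂ) ∈ essSpectrum S} (alphaMinus S) := by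
  rw [setOf_mem_essSpectrum_eq_neg, alphaMinus_eq_neg_alphaPlus]
  have h := isGreatest_alphaPlus hS.neg hH
  exact ⟨by simpa using h.1, fun t ht => neg_le.mp (h.2 ht)⟩

lemma isCompactOperator_minusPart {S : H →L[ℂ] H} (hS : IsSelfAdjoint S)
    (hH : ¬ FiniteDimensional ℂ H) : IsCompactOperator (minusPart S) := by
  rw [minusPart_eq_neg_plusPart hS]
  exact (isCompactOperator_plusPart hS.neg hH).neg

lemma lowerSum_eq_lowerSum_minusPart_add {S : H →L[ℂ] H} (hS : IsSelfAdjoint S)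
    (hH : ¬ FiniteDimensional ℂ H) (k : ℕ) :
    lowerSum k S = lowerSum k (minusPart S) + k * alphaMinus S := by
  rw [lowerSum_eq_neg_upperSum, lowerSum_eq_neg_upperSum, minusPart_eq_neg_plusPart hS, neg_neg,
    alphaMinus_eq_neg_alphaPlus, upperSum_eq_upperSum_plusPart_add hS.neg hH]
  ring

lemma tendsto_lowerSum_div {S : H →L[ℂ] H} (hS : IsSelfAdjoint S)
    (hH : ¬ FiniteDimensional ℂ H) :
    Tendsto (fun k : ℕ => lowerSum k S / k) atTop (𝓝 (alphaMinus S)) := by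
  rw [alphaMinus_eq_neg_alphaPlus]
  refine (tendsto_upperSum_div hS.neg hH).neg.congr fun k => ?_
  rw [lowerSum_eq_neg_upperSum, neg_div]

/-- Compact perturbations preserve the essential spectrum, so `t` lies in the spectrum of `S + K`.
-/
lemma abs_le_norm_add_of_mem_essSpectrum {S K : H →L[ℂ] H} (hK : IsCompactOperator K) {t : ℝ}
    (ht : (t : ℂ) ∈ essSpectrum S) : |t| ≤ ‖S + K‖ := by
  have h : essSpectrum S = essSpectrum (S + K) := by
    refine essSpectrum_congr ?_
    rw [sub_add_cancel_left]
    exact hK.neg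
  rw [h] at ht
  have hmem := essSpectrum_subset_spectrum _ ht
  rcases subsingleton_or_nontrivial H with hsub | hnt
  · exact absurd hmem (by simp)
  · simpa using spectrum.norm_le_norm_of_mem hmem

lemma essNorm_eq_max {S : H →L[ℂ] H} (hS : IsSelfAdjoint S) (hH : ¬ FiniteDimensional ℂ H) :
    essNorm S = max (alphaPlus S) (-alphaMinus S) := by
  have hg := isGreatest_alphaPlus hS hH
  have hl := isLeast_alphaMinus hS hH
  have hle : alphaMinus S ≤ alphaPlus S := hg.2 hl.1
  refine le_antisymm ?_ ?_
  -- With this `K`, `S + K` is `S` truncated to `[α₋, α⁺]`, so its norm is at most `max α⁺ (-α₋)`.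
  · have hK : IsCompactOperator (-plusPart S - minusPart S : H →L[ℂ] H) :=
      (isCompactOperator_plusPart hS hH).neg.sub (isCompactOperator_minusPart hS hH)
    have hbdd : BddBelow {r : ℝ | ∃ K : H →L[ℂ] H, IsCompactOperator K ∧ r = ‖S + K‖} := by
      refine ⟨0, ?_⟩
      rintro r ⟨K, -, rfl⟩
      exact norm_nonneg _
    refine (csInf_le hbdd ⟨_, hK, rfl⟩).trans ?_
    have hSK : S + (-plusPart S - minusPart S) = cfc (fun s : ℝ =>
        s - max (s - alphaPlus S) 0 - min (s - alphaMinus S) 0) S := by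
      rw [cfc_sub (fun s : ℝ => s - max (s - alphaPlus S) 0)
          (fun s : ℝ => min (s - alphaMinus S) 0) S,
        cfc_sub (fun s : ℝ => s) (fun s : ℝ => max (s - alphaPlus S) 0) S, cfc_id' ℝ S,
        ← plusPart_eq_cfc hS, ← minusPart_eq_cfc hS]
      abel
    rw [hSK]
    have h1 := le_max_left (alphaPlus S) (-alphaMinus S)
    have h2 := le_max_right (alphaPlus S) (-alphaMinus S)
    refine norm_cfc_le (by linarith) fun s _ => ?_
    rw [Real.norm_eq_abs, abs_le]
    rcases le_total s (alphaPlus S) with h3 | h3 <;>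
    rcases le_total s (alphaMinus S) with h4 | h4
    · rw [max_eq_right (a := s - _) (by linarith), min_eq_left (by linarith)]
      constructor <;> linarith
    · rw [max_eq_right (a := s - _) (by linarith), min_eq_right (by linarith)]
      constructor <;> linarith
    · rw [max_eq_left (b := (0 : ℝ)) (by linarith), min_eq_left (by linarith)]
      constructor <;> linarith
    · rw [max_eq_left (b := (0 : ℝ)) (by linarith), min_eq_right (by linarith)]
      constructor <;> linarith
  · refine le_csInf ⟨_, 0, isCompactOperator_zero, rfl⟩ ?_
    rintro r ⟨K, hK, rfl⟩
    exact max_le ((le_abs_self _).trans (abs_le_norm_add_of_mem_essSpectrum hK hg.1))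
      ((neg_le_abs _).trans (abs_le_norm_add_of_mem_essSpectrum hK hl.1))

lemma nonneg_alphaMinus_of_isPositive {S : H →L[ℂ] H} (hS : S.IsPositive)
    (hH : ¬ FiniteDimensional ℂ H) : 0 ≤ alphaMinus S := by
  have h := essSpectrum_subset_spectrum S (isLeast_alphaMinus hS.isSelfAdjoint hH).1
  have h0 : 0 ≤ S := (ContinuousLinearMap.nonneg_iff_isPositive S).mpr hS
  exact spectrum_nonneg_of_nonneg h0 (spectrum.of_algebraMap_mem ℂ h)

end Parts

end SelfAdjointSchurHorn

theorem proposition3p5 {H : Type*} [NormedAddCommGroup H] [InnerProductSpace ℂ H]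
    [CompleteSpace H] [TopologicalSpace.SeparableSpace H] (hH : ¬ FiniteDimensional ℂ H)
    (S : H →L[ℂ] H) (hS : IsSelfAdjoint S) :
    IsGreatest {t : ℝ | (t : ℂ) ∈ essSpectrum S} (alphaPlus S) ∧
    IsLeast {t : ℝ | (t : ℂ) ∈ essSpectrum S} (alphaMinus S) ∧
    IsCompactOperator (plusPart S) ∧
    IsCompactOperator (minusPart S) ∧
    (∀ k : ℕ, upperSum k S = upperSum k (plusPart S) + k * alphaPlus S) ∧
    (∀ k : ℕ, lowerSum k S = lowerSum k (minusPart S) + k * alphaMinus S) ∧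
    Tendsto (fun k : ℕ => upperSum k S / k) atTop (𝓝 (alphaPlus S)) ∧
    Tendsto (fun k : ℕ => lowerSum k S / k) atTop (𝓝 (alphaMinus S)) ∧
    essNorm S = max (alphaPlus S) (-alphaMinus S) ∧
    (-alphaMinus S ≤ alphaPlus S →
      Tendsto (fun k : ℕ => upperSum k S / k) atTop (𝓝 (essNorm S))) ∧
    (S.IsPositive → Tendsto (fun k : ℕ => upperSum k S / k) atTop (𝓝 (essNorm S))) := by
  have hpos := tendsto_upperSum_div hS hH
  have hnorm := essNorm_eq_max hS hH
  have hlim : -alphaMinus S ≤ alphaPlus S →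
      Tendsto (fun k : ℕ => upperSum k S / k) atTop (𝓝 (essNorm S)) := fun h => by
    rwa [hnorm, max_eq_left h]
  refine ⟨isGreatest_alphaPlus hS hH, isLeast_alphaMinus hS hH, isCompactOperator_plusPart hS hH,
    isCompactOperator_minusPart hS hH, upperSum_eq_upperSum_plusPart_add hS hH,
    lowerSum_eq_lowerSum_minusPart_add hS hH, hpos, tendsto_lowerSum_div hS hH, hnorm, hlim,
    fun hS' => hlim ?_⟩
  have h0 := nonneg_alphaMinus_of_isPositive hS' hH
  have hle : alphaMinus S ≤ alphaPlus S :=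
    (isGreatest_alphaPlus hS hH).2 (isLeast_alphaMinus hS hH).1
  linarith
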